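/- Let $G$ be a finite simple undirected graph which is an Euler graph, i.e. $G$ is connected and has a closed trail that traverses every edge of $G$ exactly once. If every cycle of $G$ has length $\equiv 1 \pmod 4$, then $G$ is planar, i.e. $G$ can be drawn in the Euclidean plane with its vertices as distinct points and each edge as a simple arc joining the points of its two end vertices and passing through no other vertex point, so that two distinct edges meet at most in the point of a common end vertex. -/

import Mathlib

namespace EulerWorld

variable {V : Type*}

/-- An Euler graph: a connected graph with a closed trail that traverses every edge exactly once. -/
def IsEulerGraph [DecidableEq V] (G : SimpleGraph V) : Prop :=
  G.Connected ∧ ∃ (u : V) (p : G.Walk u u), p.IsEulerian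

/-- The class `ε_i`: Euler graphs all of whose cycles have length congruent to `i` modulo `4`. -/
def IsEpsilon [DecidableEq V] (i : ℕ) (G : SimpleGraph V) : Prop :=
  IsEulerGraph G ∧ ∀ (u : V) (c : G.Walk u u), c.IsCycle → c.length ≡ i [MOD 4]

/-- An embedding of the simple graph `G` in the Euclidean plane: the vertices are distinct points,
each edge `uv` is a simple arc joining the points of `u` and `v` and passing through no other vertex
point, and two distinct edges meet at most in the point of a common end vertex. -/
structure PlaneEmbedding (G : SimpleGraph V) where
  /-- the point representing a vertex -/
  point : V → EuclideanSpace ℝ (Fin 2)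
  /-- the set of points of the plane representing an edge (irrelevant on non-edges) -/
  arc : Sym2 V → Set (EuclideanSpace ℝ (Fin 2))
  point_injective : Function.Injective point
  arc_isArc : ∀ u v : V, G.Adj u v →
    ∃ γ : Path (point u) (point v), Function.Injective γ ∧ Set.range γ = arc s(u, v)
  mem_of_point_mem_arc : ∀ e ∈ G.edgeSet, ∀ w : V, point w ∈ arc e → w ∈ e
  arc_inter_arc : ∀ e ∈ G.edgeSet, ∀ f ∈ G.edgeSet, e ≠ f → ∀ x ∈ arc e ∩ arc f,
    ∃ w : V, w ∈ e ∧ w ∈ f ∧ x = point w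

/-- A graph is planar if it can be embedded in the plane. -/
def IsPlanar (G : SimpleGraph V) : Prop :=
  Nonempty (PlaneEmbedding G)

end EulerWorld

/-! ### Edge-disjoint walks and alternation along a trail. -/

open SimpleGraph

namespace EulerWorld

/-! All cycles are odd, whereas three internally disjoint paths would give cycles of total length
twice the sum of the path lengths. So no two vertices are joined by three edge-disjoint walks
(`not_three_edgeDisjoint_walks`), and the Euler trail never visits two vertices in the pattern x, y,
x, y. Ordered by first visit, the vertices then have no crossing edges
(`not_crossing_of_not_alternating`), so chords of a convex curve, here a parabola, draw the graph
(`isPlanar_of_not_crossing`). -/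

/-- If every cycle of `G` is odd, two distinct vertices are not joined by three walks that pairwise
have no edge in common. -/
theorem not_three_edgeDisjoint_walks {V : Type*} [DecidableEq V] {G : SimpleGraph V}
    (hodd : ∀ (u : V) (c : G.Walk u u), c.IsCycle → Odd c.length) {x y : V} (hxy : x ≠ y)
    (p q r : G.Walk x y) (hpq : p.edges.Disjoint q.edges) (hpr : p.edges.Disjoint r.edges)
    (hqr : q.edges.Disjoint r.edges) : False := by
  induction hn : p.length + q.length + r.length using Nat.strong_induction_on
    generalizing x y with
  | _ n ih =>
  -- in a minimal counterexample every walk is a path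
  have path : ∀ p q r : G.Walk x y, p.edges.Disjoint q.edges → p.edges.Disjoint r.edges →
      q.edges.Disjoint r.edges → p.length + q.length + r.length = n → p.IsPath := by
    intro p q r hpq hpr hqr hn
    by_contra hp
    have hlt : p.bypass.length < p.length := by
      by_contra! hle
      exact hp (p.bypass_eq_self_of_length_le_length_bypass hle ▸ p.bypass_isPath)
    exact ih _ (by omega) hxy p.bypass q r
      (fun e he => hpq (p.edges_bypass_subset_edges he))
      (fun e he => hpr (p.edges_bypass_subset_edges he)) hqr rfl
  -- and two of the walks meet only at their ends
  have inner : ∀ p q r : G.Walk x y, p.edges.Disjoint q.edges → p.edges.Disjoint r.edges →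
      q.edges.Disjoint r.edges → p.length + q.length + r.length = n →
      ∀ z ∈ p.support, z ∈ q.support → z = x ∨ z = y := by
    intro p q r hpq hpr hqr hn z hzp hzq
    by_contra! hz
    have hl : (q.takeUntil z hzq).length < q.length := q.length_takeUntil_lt_length hzq hz.2
    have hl' : (p.takeUntil z hzp).length + (p.dropUntil z hzp).length = p.length := by
      rw [← Walk.length_append, Walk.take_spec]
    -- Reroute to `z`: the part of `q` after `z` is dropped, so the total length decreases.
    refine ih _ ?_ (Ne.symm hz.1) (r.append (p.dropUntil z hzp).reverse) (q.takeUntil z hzq)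
      (p.takeUntil z hzp) ?_ ?_ ?_ rfl
    · simp only [Walk.length_append, Walk.length_reverse]
      omega
    all_goals
      intro e he he'
      try simp only [Walk.edges_append, Walk.edges_reverse, List.mem_append, List.mem_reverse] at he
    · rcases he with he | he
      · exact hqr (q.edges_takeUntil_subset_edges hzq he') he
      · exact hpq (p.edges_dropUntil_subset_edges hzp he) (q.edges_takeUntil_subset_edges hzq he')
    · rcases he with he | he
      · exact hpr (p.edges_takeUntil_subset_edges hzp he') he
      · exact (path p q r hpq hpr hqr hn).isTrail.disjoint_edges_takeUntil_dropUntil hzp he' he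
    · exact hpq (p.edges_takeUntil_subset_edges hzp he') (q.edges_takeUntil_subset_edges hzq he)
  have cyc : ∀ p q r : G.Walk x y, p.edges.Disjoint q.edges → p.edges.Disjoint r.edges →
      q.edges.Disjoint r.edges → p.length + q.length + r.length = n →
      Odd (p.length + q.length) := by
    intro p q r hpq hpr hqr hn
    have hp := path p q r hpq hpr hqr hn
    have hq := path q p r hpq.symm hqr hpr (by omega)
    have hi := inner p q r hpq hpr hqr hn
    have hc : (p.append q.reverse).IsCycle := by
      refine hp.isCycle_append hq.reverse (fun z hz hz' => ?_) ?_
      · rcases hi z (List.mem_of_mem_tail hz)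
          (by simpa using List.mem_of_mem_tail hz') with rfl | rfl
        · have := hp.support_nodup
          rw [← Walk.cons_tail_support] at this
          exact (List.nodup_cons.1 this).1 hz
        · have := hq.reverse.support_nodup
          rw [← Walk.cons_tail_support] at this
          exact (List.nodup_cons.1 this).1 hz'
      -- Two paths of length one would both consist of the edge `s(x, y)`.
      · by_contra! hle
        rw [Walk.length_reverse] at hle
        cases p with
        | nil => exact hxy rfl
        | cons h p =>
        cases q with
        | nil => exact hxy rfl
        | cons h' q =>
        obtain rfl := Walk.eq_of_length_eq_zero (p := p) (by simpa using hle.1)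
        obtain rfl := Walk.eq_of_length_eq_zero (p := q) (by simpa using hle.2)
        exact hpq (List.mem_cons_self : _ ∈ s(x, _) :: p.edges)
          (List.mem_cons_self : _ ∈ s(x, _) :: q.edges)
    simpa using hodd _ _ hc
  have h1 := cyc p q r hpq hpr hqr hn
  have h2 := cyc p r q hpr hpq hqr.symm (by omega)
  have h3 := cyc q r p hqr hpq.symm hpr.symm (by omega)
  -- Three odd numbers cannot add up to twice the total length.
  grind

theorem exists_walk_of_adj_succ {V : Type*} {G : SimpleGraph V} (g : ℕ → V) {i j : ℕ}
    (hij : i ≤ j) (h : ∀ m, i ≤ m → m < j → G.Adj (g m) (g (m + 1))) :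
    ∃ w : G.Walk (g i) (g j), ∀ e ∈ w.edges, ∃ m, i ≤ m ∧ m < j ∧ e = s(g m, g (m + 1)) := by
  induction j, hij using Nat.le_induction with
  | base => exact ⟨.nil, by simp⟩
  | succ j hij ih =>
    obtain ⟨w, hw⟩ := ih fun m h1 h2 => h m h1 (by omega)
    refine ⟨w.concat (h j hij (by omega)), fun e he => ?_⟩
    rw [Walk.edges_concat, List.concat_eq_append, List.mem_append, List.mem_singleton] at he
    rcases he with he | rfl
    · obtain ⟨m, h1, h2, h3⟩ := hw e he
      exact ⟨m, h1, by omega, h3⟩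
    · exact ⟨j, hij, by omega, rfl⟩

/-- If every cycle of `G` is odd, a trail does not visit two distinct vertices alternately. -/
theorem IsTrail.getVert_eq_of_alternating {V : Type*} [DecidableEq V] {G : SimpleGraph V}
    (hodd : ∀ (u : V) (c : G.Walk u u), c.IsCycle → Odd c.length) {u v : V} {p : G.Walk u v}
    (hp : p.IsTrail) {i j k l : ℕ} (hij : i < j) (hjk : j < k) (hkl : k < l) (hl : l ≤ p.length)
    (hik : p.getVert i = p.getVert k) (hjl : p.getVert j = p.getVert l) :
    p.getVert i = p.getVert j := by
  by_contra hne
  have key : ∀ i j, i ≤ j → j ≤ p.length → ∃ w : G.Walk (p.getVert i) (p.getVert j),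
      ∀ e ∈ w.edges, ∃ m, i ≤ m ∧ m < j ∧ e = s(p.getVert m, p.getVert (m + 1)) :=
    fun i j hij hj => exists_walk_of_adj_succ p.getVert hij
      fun m _ hm => p.adj_getVert_succ (by omega)
  have inj : ∀ m m', m < p.length → m' < p.length →
      s(p.getVert m, p.getVert (m + 1)) = s(p.getVert m', p.getVert (m' + 1)) → m = m' := by
    intro m m' hm hm' h
    rw [← p.length_edges] at hm hm'
    rw [← p.getElem_edges hm, ← p.getElem_edges hm'] at h
    exact (hp.edges_nodup.getElem_inj_iff).1 h
  obtain ⟨a, ha⟩ := key i j hij.le (by omega)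
  obtain ⟨b, hb⟩ := key j k hjk.le (by omega)
  obtain ⟨c, hc⟩ := key k l hkl.le (by omega)
  -- The three stretches between consecutive visits all join the same two vertices.
  refine not_three_edgeDisjoint_walks hodd hne a (b.reverse.copy hik.symm rfl)
    (c.copy hik.symm hjl.symm) ?_ ?_ ?_
  all_goals
    intro e he he'
    simp only [Walk.edges_copy, Walk.edges_reverse, List.mem_reverse] at he he'
  · obtain ⟨m, h1, h2, rfl⟩ := ha e he
    obtain ⟨m', h1', h2', h⟩ := hb _ he'
    have := inj m m' (by omega) (by omega) h
    omega
  · obtain ⟨m, h1, h2, rfl⟩ := ha e he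
    obtain ⟨m', h1', h2', h⟩ := hc _ he'
    have := inj m m' (by omega) (by omega) h
    omega
  · obtain ⟨m, h1, h2, rfl⟩ := hb e he
    obtain ⟨m', h1', h2', h⟩ := hc _ he'
    have := inj m m' (by omega) (by omega) h
    omega

/-- Replace each term of a finite sequence by the index `F i` of its first occurrence. If no two
values alternate in the sequence, the pairs of consecutive terms do not cross. -/
theorem not_crossing_of_not_alternating {F : ℕ → ℕ} {n : ℕ} (hle : ∀ i, F i ≤ i)
    (hidem : ∀ i, F (F i) = F i)
    (halt : ∀ i j k l, i < j → j < k → k < l → l ≤ n → F i = F k → F j = F l → F i = F j)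
    {a b c d i j : ℕ} (hi : i < n) (hj : j < n)
    (hac : F i = a ∧ F (i + 1) = c ∨ F i = c ∧ F (i + 1) = a)
    (hbd : F j = b ∧ F (j + 1) = d ∨ F j = d ∧ F (j + 1) = b)
    (hab : a < b) (hbc : b < c) (hcd : c < d) : False := by
  -- the value `b` occurs at `k`, next to an occurrence of `d` at `q`
  obtain ⟨k, q, hk, hq, hkn, hqn, hkq, hqk⟩ :
      ∃ k q, F k = b ∧ F q = d ∧ k ≤ n ∧ q ≤ n ∧ k ≤ q + 1 ∧ q ≤ k + 1 := by
    rcases hbd with ⟨h1, h2⟩ | ⟨h1, h2⟩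
    · exact ⟨j, j + 1, h1, h2, by omega, by omega, by omega, by omega⟩
    · exact ⟨j + 1, j, h2, h1, by omega, by omega, by omega, by omega⟩
  have hbb : F b = b := by rw [← hk, hidem]
  have hdd : F d = d := by rw [← hq, hidem]
  have hbk : b ≤ k := hk ▸ hle k
  have hdq : d ≤ q := hq ▸ hle q
  -- Since `F` fixes `a`, `b`, `c`, these numbers are also positions of their own values. The
  -- alternating pattern is a, c, a, c if `c < i + 1`, and a, b, a, b if `c = i + 1`.
  rcases hac with ⟨h1, h2⟩ | ⟨h1, h2⟩
  · have haa : F a = a := by rw [← h1, hidem]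
    have hcc : F c = c := by rw [← h2, hidem]
    have hai : a ≤ i := h1 ▸ hle i
    have hci : c ≤ i + 1 := h2 ▸ hle (i + 1)
    rcases hci.lt_or_eq with hci | hci
    · have : c ≠ i := by rintro rfl; omega
      have := halt a c i (i + 1) (by omega) (by omega) (by omega) (by omega) (by omega) (by omega)
      omega
    · have : b ≠ i := by rintro rfl; omega
      have : k ≠ i := by rintro rfl; omega
      have := halt a b i k (by omega) (by omega) (by omega) hkn (by omega) (by omega)
      omega
  · have haa : F a = a := by rw [← h2, hidem]
    have hcc : F c = c := by rw [← h1, hidem]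
    have hci : c ≤ i := h1 ▸ hle i
    -- Otherwise the pattern a, b, a, b occurs; below, `k ≤ i` forces b, c, b, c.
    have hki : k ≤ i := by
      by_contra! h
      have : k ≠ i + 1 := by rintro rfl; omega
      have := halt a b (i + 1) k (by omega) (by omega) (by omega) hkn (by omega) (by omega)
      omega
    have : q ≠ i + 1 := by rintro rfl; omega
    have : q ≠ i := by rintro rfl; omega
    have : k ≠ i := by rintro rfl; omega
    have : k ≠ c := by rintro rfl; omega
    have := halt b c k i (by omega) (by omega) (by omega) (by omega) (by omega) (by omega)
    omega

end EulerWorld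

/-! ### Chords of a parabola. -/

namespace EulerWorld

/-- The point of the standard parabola with abscissa `t`. -/
noncomputable def parabola (t : ℝ) : EuclideanSpace ℝ (Fin 2) := !₂[t, t ^ 2]

theorem parabola_injective : Function.Injective parabola := fun s t h => by
  simpa [parabola] using congrArg (fun x : EuclideanSpace ℝ (Fin 2) => x 0) h

/-- The height of a chord above the parabola is a product of two linear factors, so intersecting
chords amounts to comparing products. -/
theorem mem_segment_parabola {a b : ℝ} (hab : a ≤ b) {x : EuclideanSpace ℝ (Fin 2)}
    (hx : x ∈ segment ℝ (parabola a) (parabola b)) :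
    a ≤ x 0 ∧ x 0 ≤ b ∧ x 1 = x 0 ^ 2 + (x 0 - a) * (b - x 0) := by
  obtain ⟨s, t, hs, ht, hst, rfl⟩ := hx
  obtain rfl : s = 1 - t := by linarith
  simp only [parabola, PiLp.add_apply, PiLp.smul_apply, smul_eq_mul]
  simp
  refine ⟨by nlinarith, by nlinarith, by ring⟩

theorem eq_parabola_of_mem_segment {a b : ℝ} (hab : a ≤ b) {x : EuclideanSpace ℝ (Fin 2)}
    (hx : x ∈ segment ℝ (parabola a) (parabola b)) (h : x 0 = a ∨ x 0 = b) :
    x = parabola (x 0) := by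
  obtain ⟨-, -, h3⟩ := mem_segment_parabola hab hx
  ext i
  fin_cases i
  · simp [parabola]
  · rcases h with h | h <;> simpa [parabola, h] using h3

/-- A chord of the parabola meets the parabola only at its ends. -/
theorem eq_or_eq_of_parabola_mem_segment {a b t : ℝ} (hab : a ≤ b)
    (h : parabola t ∈ segment ℝ (parabola a) (parabola b)) : t = a ∨ t = b := by
  obtain ⟨-, -, h3⟩ := mem_segment_parabola hab h
  simp [parabola, sub_eq_zero] at h3
  grind

/-- If `s` were interior to both intervals, they would be nested, and the larger one would give the
strictly larger product. -/
theorem ends_of_mul_eq_mul {a b c d s : ℝ} (h1 : ¬ (a < c ∧ c < b ∧ b < d))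
    (h2 : ¬ (c < a ∧ a < d ∧ d < b)) (hne : ¬ (a = c ∧ b = d)) (ha : a ≤ s) (hb : s ≤ b)
    (hc : c ≤ s) (hd : s ≤ d) (h : (s - a) * (b - s) = (s - c) * (d - s)) :
    (s = a ∨ s = b) ∧ (s = c ∨ s = d) := by
  have zero : ∀ u v : ℝ, (s - u) * (v - s) = 0 → s = u ∨ s = v := fun u v h =>
    (mul_eq_zero.1 h).imp sub_eq_zero.1 fun h => (sub_eq_zero.1 h).symm
  suffices h0 : (s - a) * (b - s) = 0 from ⟨zero _ _ h0, zero _ _ (h ▸ h0)⟩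
  by_contra h0
  have hsa : 0 < s - a := (sub_nonneg.2 ha).lt_of_ne' (left_ne_zero_of_mul h0)
  have hsb : 0 < b - s := (sub_nonneg.2 hb).lt_of_ne' (right_ne_zero_of_mul h0)
  rw [h] at h0
  have hsc : 0 < s - c := (sub_nonneg.2 hc).lt_of_ne' (left_ne_zero_of_mul h0)
  have hsd : 0 < d - s := (sub_nonneg.2 hd).lt_of_ne' (right_ne_zero_of_mul h0)
  rcases lt_trichotomy a c with hac | rfl | hac
  · have hdb : d ≤ b := not_lt.1 fun hlt => h1 ⟨hac, by linarith, hlt⟩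
    nlinarith
  · exact hne ⟨rfl, by linarith [mul_left_cancel₀ hsa.ne' h]⟩
  · have hbd : b ≤ d := not_lt.1 fun hlt => h2 ⟨hac, by linarith, hlt⟩
    nlinarith

/-- Two distinct chords of the parabola that do not cross meet only at a common end. -/
theorem eq_parabola_of_mem_segment_inter {a b c d : ℝ} (hab : a < b) (hcd : c < d)
    (h1 : ¬ (a < c ∧ c < b ∧ b < d)) (h2 : ¬ (c < a ∧ a < d ∧ d < b))
    (hne : ¬ (a = c ∧ b = d)) {x : EuclideanSpace ℝ (Fin 2)}
    (hx : x ∈ segment ℝ (parabola a) (parabola b))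
    (hx' : x ∈ segment ℝ (parabola c) (parabola d)) :
    ∃ t, (t = a ∨ t = b) ∧ (t = c ∨ t = d) ∧ x = parabola t := by
  obtain ⟨ha, hb, h⟩ := mem_segment_parabola hab.le hx
  obtain ⟨hc, hd, h'⟩ := mem_segment_parabola hcd.le hx'
  have key : (x 0 = a ∨ x 0 = b) ∧ (x 0 = c ∨ x 0 = d) := by
    exact ends_of_mul_eq_mul h1 h2 hne ha hb hc hd (by linarith)
  exact ⟨x 0, key.1, key.2, eq_parabola_of_mem_segment hab.le hx key.1⟩

/-- A graph whose vertices can be linearly ordered so that no two edges cross is planar. -/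
theorem isPlanar_of_not_crossing {V : Type*} {G : SimpleGraph V} (f : V → ℕ)
    (hf : Function.Injective f)
    (h : ∀ a b c d : V, G.Adj a c → G.Adj b d → f a < f b → f b < f c → f c < f d → False) :
    IsPlanar G := by
  have hinj : Function.Injective fun v => parabola (f v) :=
    parabola_injective.comp (Nat.cast_injective.comp hf)
  have ordered : ∀ e ∈ G.edgeSet, ∃ u v, e = s(u, v) ∧ G.Adj u v ∧ f u < f v := by
    intro e he
    induction e using Sym2.ind with
    | _ u v =>
    rw [SimpleGraph.mem_edgeSet] at he
    rcases lt_or_gt_of_ne (hf.ne he.ne) with hlt | hlt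
    · exact ⟨u, v, rfl, he, hlt⟩
    · exact ⟨v, u, Sym2.eq_swap, he.symm, hlt⟩
  refine ⟨{
    point := fun v => parabola (f v)
    arc := Sym2.lift ⟨fun u v => segment ℝ (parabola (f u)) (parabola (f v)),
      fun u v => segment_symm ℝ _ _⟩
    point_injective := hinj
    arc_isArc := ?_
    mem_of_point_mem_arc := ?_
    arc_inter_arc := ?_ }⟩
  · intro u v huv
    refine ⟨⟨⟨fun t => AffineMap.lineMap (parabola (f u)) (parabola (f v)) (t : ℝ),
      AffineMap.lineMap_continuous.comp continuous_subtype_val⟩, by simp, by simp⟩, ?_, ?_⟩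
    · exact (AffineMap.lineMap_injective ℝ (hinj.ne huv.ne)).comp Subtype.val_injective
    · change _ = segment ℝ (parabola (f u)) (parabola (f v))
      rw [segment_eq_image_lineMap, Set.image_eq_range]
      rfl
  · intro e he w hw
    obtain ⟨u, v, rfl, -, huv⟩ := ordered e he
    rcases eq_or_eq_of_parabola_mem_segment (Nat.cast_le.2 huv.le) hw with h | h <;>
      simp [hf (Nat.cast_injective h)]
  · rintro e he e' he' hne x ⟨hx, hx'⟩
    obtain ⟨u, v, rfl, hadj, huv⟩ := ordered e he
    obtain ⟨u', v', rfl, hadj', huv'⟩ := ordered e' he'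
    obtain ⟨t, ht, ht', rfl⟩ := eq_parabola_of_mem_segment_inter (Nat.cast_lt.2 huv)
      (Nat.cast_lt.2 huv')
      (fun ⟨h1, h2, h3⟩ => h u u' v v' hadj hadj' (Nat.cast_lt.1 h1) (Nat.cast_lt.1 h2)
        (Nat.cast_lt.1 h3))
      (fun ⟨h1, h2, h3⟩ => h u' u v' v hadj' hadj (Nat.cast_lt.1 h1) (Nat.cast_lt.1 h2)
        (Nat.cast_lt.1 h3))
      (fun ⟨h1, h2⟩ => hne (by rw [hf (Nat.cast_injective h1), hf (Nat.cast_injective h2)]))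
      hx hx'
    have mem : ∀ w u v : V, (f w : ℝ) = f u ∨ (f w : ℝ) = f v → w ∈ s(u, v) := by
      intro w u v h
      simpa [hf.eq_iff] using h
    rcases ht with rfl | rfl
    · exact ⟨u, by simp, mem _ _ _ ht', rfl⟩
    · exact ⟨v, by simp, mem _ _ _ ht', rfl⟩

end EulerWorld

/-! ### Ordering the vertices along the Euler trail. -/

theorem corollary8p1 {V : Type*} [Fintype V] [DecidableEq V] (G : SimpleGraph V)
    (hG : EulerWorld.IsEpsilon 1 G) : EulerWorld.IsPlanar G := by
  obtain ⟨⟨hconn, u, p, hp⟩, hcyc⟩ := hG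
  have hodd : ∀ (u : V) (c : G.Walk u u), c.IsCycle → Odd c.length := by
    intro u c hc
    have := hcyc u c hc
    rw [Nat.odd_iff]
    unfold Nat.ModEq at this
    omega
  have hedge : ∀ a c, G.Adj a c → ∃ i < p.length,
      p.getVert i = a ∧ p.getVert (i + 1) = c ∨ p.getVert i = c ∧ p.getVert (i + 1) = a := by
    intro a c hac
    obtain ⟨i, hi, h⟩ := List.mem_iff_getElem.1 (hp.mem_edges_iff.2 (G.mem_edgeSet.2 hac))
    rw [p.getElem_edges hi, Sym2.eq_iff] at h
    exact ⟨i, by simpa using hi, h⟩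
  -- By connectedness each vertex lies on an edge, hence on the trail, unless it is the only vertex.
  have hvert : ∀ v, ∃ i, p.getVert i = v := by
    intro v
    rcases subsingleton_or_nontrivial V with _ | _
    · exact ⟨0, Subsingleton.elim _ _⟩
    · obtain ⟨w, hw⟩ := hconn.preconnected.exists_adj_of_nontrivial v
      obtain ⟨i, -, h | h⟩ := hedge v w hw
      · exact ⟨i, h.1⟩
      · exact ⟨i + 1, h.2⟩
  have hspec : ∀ v, p.getVert (Nat.find (hvert v)) = v := fun v => Nat.find_spec (hvert v)
  have hinj : Function.Injective fun v => Nat.find (hvert v) :=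
    Function.LeftInverse.injective (g := p.getVert) hspec
  refine EulerWorld.isPlanar_of_not_crossing _ hinj fun a b c d hac hbd h1 h2 h3 => ?_
  obtain ⟨i, hi, hac⟩ := hedge a c hac
  obtain ⟨j, hj, hbd⟩ := hedge b d hbd
  refine EulerWorld.not_crossing_of_not_alternating
    (F := fun i => Nat.find (hvert (p.getVert i))) (n := p.length)
    (fun i => Nat.find_min' _ rfl) (fun i => by simp only [hspec]) ?_ hi hj
    (hac.imp (And.imp (by rintro rfl; rfl) (by rintro rfl; rfl))
      (And.imp (by rintro rfl; rfl) (by rintro rfl; rfl)))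
    (hbd.imp (And.imp (by rintro rfl; rfl) (by rintro rfl; rfl))
      (And.imp (by rintro rfl; rfl) (by rintro rfl; rfl))) h1 h2 h3
  intro i j k l hij hjk hkl hl hik hjl
  exact congrArg (fun v => Nat.find (hvert v)) (EulerWorld.IsTrail.getVert_eq_of_alternating hodd
    hp.isTrail hij hjk hkl hl (hinj hik) (hinj hjl))
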